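/- **Setting.** Let $\mathcal N$, $\mathcal F$ and $\mathcal M$ be finite sets of nodes, tones and multicast sessions, and let $\mathcal A$ be a set of hyperarcs $(i,J)$, $i\in\mathcal N$, $J\subset\mathcal N$. Let $\mathcal G=\{(i,j): j\in J \text{ for some } (i,J)\in\mathcal A\}$ be the set of links and $N(i)=\{j:(i,j)\in\mathcal G\}$. Session $m$ has a source $s^m\in\mathcal N$ and a set of sinks $T^m\subset\mathcal N$. The channel $\mathbf h$ is a random vector in $\mathbb R_+^{d}$, $d\ge 1$, whose law is absolutely continuous with respect to Lebesgue measure; $\mathbb E$ is the expectation over it. Let $\Pi\subset\mathbb R^{\mathcal A\times\mathcal F}$ be bounded, and let $\mathcal P$ be the set of measurable policies $\mathbf h\mapsto\mathbf p(\mathbf h)=(p^f_{iJ}(\mathbf h))$ with $\mathbf p(\mathbf h)\in\Pi$ for almost all $\mathbf h$. The capacity functions $C^f_{iJ}$ are such that $\sum_f C^f_{iJ}(\mathbf p(\mathbf h),\mathbf h)$ is integrable for every $\mathbf p\in\mathcal P$ and every $(i,J)\in\mathcal A$. The vector $\mathbf y$ stacks the variables $a^m$, $z^m_{iJ}$, $x^{mt}_{ij}$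 ($(i,j)\in\mathcal G$, $t\in T^m$), $c_{iJ}$ and $p_i$. Let $\mathcal B$ be the set of pairs $(\mathbf y,\mathbf p)$ with $\mathbf p\in\mathcal P$ and $$a^m_{\min}\le a^m\le a^m_{\max},\quad 0\le z^m_{iJ}\le z^{\max}_{iJ},\quad 0\le x^{mt}_{ij}\le x^{\max}_{ij},\quad 0\le c_{iJ}\le c^{\max}_{iJ},\quad 0\le p_i\le p^{\max}_i .$$ Let $f(\mathbf y)=\sum_m U_m(a^m)-\sum_i V_i(p_i)$ with $U_m$ concave on $[a^m_{\min},a^m_{\max}]$ and $V_i$ convex on $[0,p_i^{\max}]$. Let $\mathsf P$ be the optimal value (supremum) of $f(\mathbf y)$ over $(\mathbf y,\mathbf p)\in\mathcal B$ subject to $$\begin{aligned} &\sigma^{m}_i\le\sum_{j:(i,j)\in\mathcal G}x^{mt}_{ij}-\sum_{j:(j,i)\in\mathcal G}x^{mt}_{ji} &&\forall m,\ t\in T^m,\ i\ne t,\\ &\sum_{j\in K}x^{mt}_{ij}\le\sum_{J:(i,J)\in\mathcal A,\,J\cap K\ne\emptyset}z^m_{iJ} &&\forall i,\ \emptyset\ne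 K\subset N(i),\ m,\ t\in T^m,\\ &\sum_m z^m_{iJ}\le c_{iJ},\qquad c_{iJ}\le\mathbb E\Big[\sum_f C^f_{iJ}(\mathbf p(\mathbf h),\mathbf h)\Big] &&\forall (i,J)\in\mathcal A,\\ &\mathbb E\Big[\sum_f\sum_{J:(i,J)\in\mathcal A}p^f_{iJ}(\mathbf h)\Big]\le p_i &&\forall i, \end{aligned}$$ where, for $i\neq t$, $\sigma_i^m=a^m$ if $i=s^m$ and $\sigma_i^m=0$ otherwise. Write these constraints as $\mathbf q(\mathbf y,\mathbf p)\le\mathbf 0$, where $\mathbf q$ is the vector of all differences "left side minus right side", and assume Slater's condition: some $(\mathbf y',\mathbf p')\in\mathcal B$ satisfies all of them strictly. Let $\mathcal L(\mathbf y,\mathbf p,\boldsymbol\zeta)=f(\mathbf y)-\boldsymbol\zeta^T\mathbf q(\mathbf y,\mathbf p)$, let $[\cdot]^+$ be the projection onto the nonnegative orthant, and let $\|\cdot\|$ be the Euclidean norm. **Method.** Let $\epsilon>0$, let $\boldsymbol\zeta(1)\ge\mathbf 0$ be arbitrary, and suppose that for all $\ell\ge1$ $$(\mathbf y(\ell),\mathbf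 p(\cdot;\ell))\in\arg\max_{(\mathbf y,\mathbf p)\in\mathcal B}\mathcal L(\mathbf y,\mathbf p,\boldsymbol\zeta(\ell)),\qquad \boldsymbol\zeta(\ell+1)=\big[\boldsymbol\zeta(\ell)+\epsilon\,\mathbf q(\mathbf y(\ell),\mathbf p(\cdot;\ell))\big]^+ .$$ Let $G$ be such that $\|\mathbf q(\mathbf y(\ell),\mathbf p(\cdot;\ell))\|\le G$ for all $\ell\ge1$, and let $\bar{\mathbf y}(s)=\frac1s\sum_{\ell=1}^s\mathbf y(\ell)$. **Proposition.** (a) There is a sequence of policies $\mathring{\mathbf p}(\cdot;s)$ such that $(\bar{\mathbf y}(s),\mathring{\mathbf p}(\cdot;s))\in\mathcal B$ for all $s\ge1$ and $\lim_{s\to\infty}\big\|[\mathbf q(\bar{\mathbf y}(s),\mathring{\mathbf p}(\cdot;s))]^+\big\|=0$. (b) $\displaystyle\liminf_{s\to\infty}f(\bar{\mathbf y}(s))\ge\mathsf P-\frac{\epsilon G^2}{2}$ and $\displaystyle\limsup_{s\to\infty}f(\bar{\mathbf y}(s))\le\mathsf P$. -/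

import Mathlib

/-- The data of a wireless coded multicast network over a random fading channel.
`Node`, `Tone`, `Session` are the (finite) sets of terminals, of tones and of multicast sessions,
and `Gain` indexes the entries of the channel vector `h`. -/
structure Network (Node Tone Session Gain : Type*) where
  /-- The hyperarcs `(i, J)`. -/
  arcs : Finset (Node × Finset Node)
  /-- The source node of each session. -/
  src : Session → Node
  /-- The sink nodes of each session. -/
  sinks : Session → Finset Node
  /-- The instantaneous power constraint set, for vectors of powers indexed by hyperarc and tone. -/
  powerSet : Set ({e // e ∈ arcs} → Tone → ℝ)
  /-- `cap e f π h` is the capacity of hyperarc `e` on tone `f` at powers `π` and channel `h`. -/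
  cap : {e // e ∈ arcs} → Tone → ({e // e ∈ arcs} → Tone → ℝ) → (Gain → ℝ) → ℝ
  /-- The distribution of the channel vector. -/
  channel : MeasureTheory.Measure (Gain → ℝ)
  aMin : Session → ℝ
  aMax : Session → ℝ
  zMax : {e // e ∈ arcs} → ℝ
  /-- The bounds on the virtual flows, read only at the pairs `(i, j)` that are links. -/
  xMax : Node × Node → ℝ
  cMax : {e // e ∈ arcs} → ℝ
  pMax : Node → ℝ
  /-- The utility of each session rate. -/
  U : Session → ℝ → ℝ
  /-- The cost of the average power of each node. -/
  V : Node → ℝ → ℝ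

namespace Network

noncomputable section

variable {Node Tone Session Gain : Type*} (net : Network Node Tone Session Gain)

/-- Hyperarcs. -/
abbrev Arc : Type _ := {e // e ∈ net.arcs}

/-- Pairs `(m, t)` of a session and one of its sinks. -/
abbrev Commodity : Type _ := (m : Session) × {t // t ∈ net.sinks m}

/-- `(i, j)` is a link if `j ∈ J` for some hyperarc `(i, J)`. -/
def IsLink (l : Node × Node) : Prop := ∃ J, (l.1, J) ∈ net.arcs ∧ l.2 ∈ J

/-- Links. -/
abbrev Link : Type _ := {l // net.IsLink l}

/-- The indices of the scalar entries of `y`: session rates `a^m`, broadcast link flows `z_{iJ}^m`,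
virtual flows `x_{ij}^{mt}`, link capacities `c_{iJ}` and average powers `p_i`. -/
inductive Var
  | a (m : Session)
  | z (e : net.Arc) (m : Session)
  | x (l : net.Link) (k : net.Commodity)
  | c (e : net.Arc)
  | p (i : Node)

/-- The indices of the relaxed constraints, that is, of the Lagrange multipliers: flow conservation
for `(m, t)` at the nodes `i ≠ t`, the union-of-flows constraints for the nonempty sets `K` of
neighbors of `i` (for `K = ∅` the constraint would read `0 ≤ 0`), link rates, link capacities, and
average powers. -/
inductive Con
  | flow (k : net.Commodity) (i : {i : Node // i ≠ k.2})
  | union (i : Node) (K : {K : Finset Node // K.Nonempty ∧ ∀ j ∈ K, net.IsLink (i, j)})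
      (k : net.Commodity)
  | rate (e : net.Arc)
  | capacity (e : net.Arc)
  | power (i : Node)

open Classical in
instance [Fintype Node] [Fintype Session] : Fintype net.Con :=
  let A := (k : net.Commodity) × {i : Node // i ≠ k.2}
  let B := ((i : Node) × {K : Finset Node // K.Nonempty ∧ ∀ j ∈ K, net.IsLink (i, j)})
    × net.Commodity
  Fintype.ofSurjective (α := A ⊕ B ⊕ net.Arc ⊕ net.Arc ⊕ Node)
    (fun
      | .inl ⟨k, i⟩ => .flow k i
      | .inr (.inl (⟨i, K⟩, k)) => .union i K k
      | .inr (.inr (.inl e)) => .rate e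
      | .inr (.inr (.inr (.inl e))) => .capacity e
      | .inr (.inr (.inr (.inr i))) => .power i)
    (by
      rintro (⟨k, i⟩ | ⟨i, K, k⟩ | e | e | i)
      · exact ⟨.inl ⟨k, i⟩, rfl⟩
      · exact ⟨.inr (.inl (⟨i, K⟩, k)), rfl⟩
      · exact ⟨.inr (.inr (.inl e)), rfl⟩
      · exact ⟨.inr (.inr (.inr (.inl e))), rfl⟩
      · exact ⟨.inr (.inr (.inr (.inr i))), rfl⟩)

/-- Power policies `h ↦ p(h)`. -/
abbrev Policy : Type _ := (Gain → ℝ) → net.Arc → Tone → ℝ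

/-- Measurable policies that satisfy the instantaneous constraints for almost all channels. -/
def policies : Set net.Policy :=
  {π | Measurable π ∧ ∀ᵐ h ∂net.channel, π h ∈ net.powerSet}

/-- The box constraints on `y`. -/
def box : Set (net.Var → ℝ) :=
  {y | (∀ m, y (.a m) ∈ Set.Icc (net.aMin m) (net.aMax m)) ∧
    (∀ e m, y (.z e m) ∈ Set.Icc 0 (net.zMax e)) ∧
    (∀ (l : net.Link) k, y (.x l k) ∈ Set.Icc 0 (net.xMax l)) ∧
    (∀ e, y (.c e) ∈ Set.Icc 0 (net.cMax e)) ∧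
    (∀ i, y (.p i) ∈ Set.Icc 0 (net.pMax i))}

/-- The set `B` of pairs `(y, p(·))` that satisfy the constraints kept implicit. -/
def admissible : Set ((net.Var → ℝ) × net.Policy) := net.box ×ˢ net.policies

/-- The objective `f(y) = ∑ U_m(a^m) - ∑ V_i(p_i)`. -/
def objective [Fintype Node] [Fintype Session] (y : net.Var → ℝ) : ℝ :=
  (∑ m, net.U m (y (.a m))) - ∑ i, net.V i (y (.p i))

open Classical in
/-- The net exogenous inflow `σ_i^m` at node `i` for session `m` and sink `t`. -/
def inflow (y : net.Var → ℝ) (k : net.Commodity) (i : Node) : ℝ :=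
  if i = net.src k.1 then y (.a k.1) else if i = k.2 then -y (.a k.1) else 0

open Classical in
/-- The constraint vector `q(y, p(·))`; the relaxed constraints are `q ≤ 0`. -/
def constraint [Fintype Node] [Fintype Tone] [Fintype Session]
    (y : net.Var → ℝ) (π : net.Policy) : net.Con → ℝ
  | .flow k i =>
      net.inflow y k i
        - ((∑ l : net.Link with l.1.1 = i.1, y (.x l k))
          - ∑ l : net.Link with l.1.2 = i.1, y (.x l k))
  | .union i K k =>
      (∑ l : net.Link with l.1.1 = i ∧ l.1.2 ∈ K.1, y (.x l k))
        - ∑ e : net.Arc with e.1.1 = i ∧ ∃ j ∈ e.1.2, j ∈ K.1, y (.z e k.1)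
  | .rate e => (∑ m, y (.z e m)) - y (.c e)
  | .capacity e => y (.c e) - ∫ h, ∑ f, net.cap e f (π h) h ∂net.channel
  | .power i =>
      (∫ h, ∑ f, ∑ e : net.Arc with e.1.1 = i, π h e f ∂net.channel) - y (.p i)

/-- The optimal value `P` of the network utility maximization problem. -/
def optimalValue [Fintype Node] [Fintype Tone] [Fintype Session] : ℝ :=
  sSup {u | ∃ y π, (y, π) ∈ net.admissible ∧ (∀ k, net.constraint y π k ≤ 0) ∧
    u = net.objective y}

/-- The Lagrangian. -/
def lagrangian [Fintype Node] [Fintype Tone] [Fintype Session]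
    (ζ : net.Con → ℝ) (w : (net.Var → ℝ) × net.Policy) : ℝ :=
  net.objective w.1 - ∑ k, ζ k * net.constraint w.1 w.2 k

/-- The projection `[v]⁺` onto the nonnegative orthant. -/
def proj (v : net.Con → ℝ) : net.Con → ℝ := fun k => max (v k) 0

/-- The Euclidean norm. -/
def norm [Fintype Node] [Fintype Session] (v : net.Con → ℝ) : ℝ :=
  Real.sqrt (∑ k, v k ^ 2)

/-- `ζ(ℓ)`, `y(ℓ)`, `p(·; ℓ)`, `ℓ = 1, 2, …`, are iterates of the synchronous dual subgradient
method with constant stepsize `ε`. The values at `ℓ = 0` play no role. -/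
structure IsSubgradientRun [Fintype Node] [Fintype Tone] [Fintype Session] (ε : ℝ)
    (ζ : ℕ → net.Con → ℝ) (y : ℕ → net.Var → ℝ) (π : ℕ → net.Policy) : Prop where
  init_nonneg : ∀ k, 0 ≤ ζ 1 k
  mem : ∀ ℓ ≥ 1, (y ℓ, π ℓ) ∈ net.admissible
  isMaxOn : ∀ ℓ ≥ 1, IsMaxOn (net.lagrangian (ζ ℓ)) net.admissible (y ℓ, π ℓ)
  update : ∀ ℓ ≥ 1, ζ (ℓ + 1) = net.proj (ζ ℓ + ε • net.constraint (y ℓ) (π ℓ))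

/-- The running average `ȳ(s)` of `y(1), …, y(s)`. -/
def runningAverage (y : ℕ → net.Var → ℝ) (s : ℕ) : net.Var → ℝ :=
  (s : ℝ)⁻¹ • ∑ ℓ ∈ Finset.Icc 1 s, y ℓ

end

end Network

/-! The obstacle is that `constraint` need not be convex in the policy, so averaging policies need
not average constraints. It is, however, linear in `y` plus an integral over the channel. Since the
channel has no atoms, following one policy on a suitable set of channel states and another elsewhere
realizes any convex combination of such integrals up to an arbitrarily small error. This is
Lyapunov's theorem in approximate form; the error can be sent to zero with `s`, so exactness is not
needed (`exists_policy_constraint_sum_le`).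

Write `q(ℓ)` for the constraint vector at step `ℓ` and `P` for the optimal value. The update gives
`ε ∑ q(ℓ) ≤ ζ(s+1)`, so the averaged violation is at most `ζ(s+1)/(ε s)`. Expanding the square of
the projected step bounds `‖ζ(s+1)‖²` by `‖ζ(1)‖² + 2ε ∑ ζ(ℓ)·q(ℓ) + s ε² G²`. Weak duality gives
`ζ(ℓ)·q(ℓ) ≤ f(y(ℓ)) - P`, which is bounded above; hence `‖ζ(s)‖ = O(√s)` and the violation
vanishes, without any bound on the multipliers.

The lower bound on the objective follows from the same inequality, weak duality and Jensen. For the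
upper bound, a small share `θ` of the Slater point makes the nearly feasible averages feasible, at a
cost of order `θ`; no continuity of `f` is needed. -/

open MeasureTheory Filter Topology

/-! ### Atomless measures and approximate Lyapunov convexity -/

/-- A finite measure for which some real random variable has no atoms can be split in any
proportion. -/
lemma exists_subset_measureReal_eq_mul {Ω : Type*} [MeasurableSpace Ω] {μ : Measure Ω}
    [IsFiniteMeasure μ] {X : Ω → ℝ} (hX : Measurable X) (hX0 : ∀ t, μ (X ⁻¹' {t}) = 0)
    {B : Set Ω} (hB : MeasurableSet B) {r : ℝ} (hr0 : 0 ≤ r) (hr1 : r ≤ 1) :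
    ∃ C ⊆ B, MeasurableSet C ∧ μ.real C = r * μ.real B := by
  rcases hr0.eq_or_lt with rfl | hr0
  · exact ⟨∅, by simp⟩
  rcases hr1.eq_or_lt with rfl | hr1
  · exact ⟨B, by simp [hB]⟩
  rcases (measureReal_nonneg (μ := μ) (s := B)).eq_or_lt with h0 | hpos
  · exact ⟨∅, by simp [← h0]⟩
  -- The unnormalized distribution function of `X` on `B` is continuous for lack of atoms and runs
  -- from `0` to `μ.real B`, so the intermediate value theorem finds a sublevel set of the required
  -- mass.
  set ν : Measure ℝ := (μ.restrict B).map X with hν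
  have hνf : IsFiniteMeasure ν := inferInstance
  have : NullSingletonClass ν := ⟨fun t => by
    rw [hν, Measure.map_apply hX (measurableSet_singleton t)]
    exact le_antisymm ((Measure.restrict_apply_le _ _).trans (hX0 t).le) bot_le⟩
  have hval : ∀ t, ν.real (Set.Iic t) = μ.real (X ⁻¹' Set.Iic t ∩ B) := fun t => by
    rw [hν, map_measureReal_apply hX measurableSet_Iic,
      measureReal_restrict_apply (hX measurableSet_Iic)]
  have huniv : ν.real Set.univ = μ.real B := by
    rw [hν, map_measureReal_apply hX MeasurableSet.univ]; simp
  have hcont : Continuous fun t => ν.real (Set.Iic t) := by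
    have h := (integrable_const (μ := ν) (1 : ℝ)).continuous_primitive 0
    have h' : (fun t => ν.real (Set.Iic t)) =
        fun t => (∫ _ in (0 : ℝ)..t, (1 : ℝ) ∂ν) + ν.real (Set.Iic 0) := by
      ext t
      rw [← intervalIntegral.integral_Iic_sub_Iic (integrable_const _).integrableOn
        (integrable_const _).integrableOn]
      simp
    rw [h']
    exact h.add continuous_const
  have hbot : Tendsto (fun t => ν.real (Set.Iic t)) atBot (𝓝 0) := by
    have h := tendsto_measure_iInter_atBot (μ := ν) (s := fun t : ℝ => Set.Iic t)
      (fun _ => measurableSet_Iic.nullMeasurableSet) monotone_Iic ⟨0, measure_ne_top _ _⟩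
    have hempty : ⋂ t : ℝ, Set.Iic t = ∅ :=
      Set.eq_empty_of_forall_notMem fun x hx =>
        (Set.mem_iInter.1 hx (x - 1) : x ≤ x - 1).not_gt (sub_one_lt x)
    simpa [measureReal_def, Function.comp_def, hempty] using
      (ENNReal.tendsto_toReal (measure_ne_top _ _)).comp h
  have htop : Tendsto (fun t => ν.real (Set.Iic t)) atTop (𝓝 (μ.real B)) := by
    rw [← huniv]
    exact (ENNReal.tendsto_toReal (measure_ne_top _ _)).comp (tendsto_measure_Iic_atTop ν)
  have hlt : r * μ.real B < μ.real B := by nlinarith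
  obtain ⟨t, ht⟩ : r * μ.real B ∈ Set.range fun t => ν.real (Set.Iic t) :=
    mem_range_of_exists_le_of_exists_ge hcont
      ((hbot.eventually_lt_const (mul_pos hr0 hpos)).exists.imp fun _ => le_of_lt)
      ((htop.eventually_const_lt hlt).exists.imp fun _ => le_of_lt)
  exact ⟨X ⁻¹' Set.Iic t ∩ B, Set.inter_subset_right, (hX measurableSet_Iic).inter hB,
    by rw [← hval]; exact ht⟩

/-- Approximate Lyapunov convexity: over an atomless measure, any fraction of a vector integral is
approximated by the integral over a suitable set. -/
lemma exists_setIntegral_near_smul {Ω E : Type*} [MeasurableSpace Ω] {μ : Measure Ω}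
    [IsFiniteMeasure μ] [NormedAddCommGroup E] [NormedSpace ℝ E] [CompleteSpace E]
    {X : Ω → ℝ} (hX : Measurable X)
    (hX0 : ∀ t, μ (X ⁻¹' {t}) = 0) {u : Ω → E} (hu : Integrable u μ) {r : ℝ} (hr0 : 0 ≤ r)
    (hr1 : r ≤ 1) {δ : ℝ} (hδ : 0 < δ) :
    ∃ A, MeasurableSet A ∧ ‖(∫ x in A, u x ∂μ) - r • ∫ x, u x ∂μ‖ < δ := by
  classical
  obtain ⟨g, hg, hgm⟩ := (memLp_one_iff_integrable.2 hu).exists_simpleFunc_eLpNorm_sub_lt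
    (by simp) (ε := ENNReal.ofReal (δ / 2)) (by simpa using hδ)
  have hgi : Integrable g μ := memLp_one_iff_integrable.1 hgm
  have hdiff : ∫ x, ‖u x - g x‖ ∂μ < δ / 2 := by
    rw [eLpNorm_one_eq_lintegral_enorm] at hg
    have h := integral_norm_eq_lintegral_enorm (hu.sub hgi).aestronglyMeasurable
    simp only [Pi.sub_apply] at h hg
    rw [h]
    exact (ENNReal.toReal_lt_of_lt_ofReal hg)
  -- Splitting every fiber of the simple function `g` in proportion `r` makes the identity exact for
  -- `g`; only the error `u - g` remains, and it is counted twice, hence `δ / 2`.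
  choose C hCsub hCm hCv using fun v : E =>
    exists_subset_measureReal_eq_mul hX hX0 (g.measurableSet_fiber v) hr0 hr1
  set A : Set Ω := ⋃ v ∈ g.range, C v with hA
  have hAm : MeasurableSet A := Finset.measurableSet_biUnion _ fun v _ => hCm v
  have hfib : ∀ v ∈ g.range, g ⁻¹' {v} ∩ A = C v := by
    intro v hv
    ext x
    simp only [hA, Set.mem_inter_iff, Set.mem_preimage, Set.mem_singleton_iff, Set.mem_iUnion]
    constructor
    · rintro ⟨hx, w, hw, hxw⟩
      have : g x = w := hCsub w hxw
      rwa [← hx, this]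
    · exact fun hx => ⟨hCsub v hx, v, hv, hx⟩
  have hgA : ∫ x in A, g x ∂μ = r • ∫ x, g x ∂μ := by
    rw [← SimpleFunc.integral_eq_integral g hgi,
      ← SimpleFunc.integral_eq_integral g hgi.restrict, SimpleFunc.integral_eq,
      SimpleFunc.integral_eq, Finset.smul_sum]
    refine Finset.sum_congr rfl fun v hv => ?_
    rw [measureReal_restrict_apply (g.measurableSet_fiber v), hfib v hv, hCv, mul_smul]
  refine ⟨A, hAm, ?_⟩
  have hug := hu.sub hgi
  have hsplit : (∫ x in A, u x ∂μ) - r • ∫ x, u x ∂μ =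
      (∫ x in A, (u x - g x) ∂μ) - r • ∫ x, (u x - g x) ∂μ := by
    rw [integral_sub hu.restrict hgi.restrict, integral_sub hu hgi, hgA, smul_sub]
    abel
  have h1 : ‖∫ x in A, (u x - g x) ∂μ‖ ≤ ∫ x, ‖u x - g x‖ ∂μ :=
    (norm_integral_le_integral_norm _).trans
      (setIntegral_le_integral hug.norm (Eventually.of_forall fun _ => norm_nonneg _))
  have h2 : ‖r • ∫ x, (u x - g x) ∂μ‖ ≤ ∫ x, ‖u x - g x‖ ∂μ := by
    rw [norm_smul, Real.norm_of_nonneg hr0]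
    calc r * ‖∫ x, (u x - g x) ∂μ‖ ≤ 1 * ∫ x, ‖u x - g x‖ ∂μ := by
          gcongr
          exact norm_integral_le_integral_norm _
      _ = _ := one_mul _
  rw [hsplit]
  calc _ ≤ _ := norm_sub_le _ _
    _ < δ := by linarith

/-! ### Two facts on convexity -/

/-- A set whose segments lie in its closure has a convex closure. -/
lemma convex_closure_of_segment_mem_closure {E : Type*} [AddCommGroup E] [Module ℝ E]
    [TopologicalSpace E] [ContinuousAdd E] [ContinuousConstSMul ℝ E] {R : Set E}
    (h : ∀ x ∈ R, ∀ y ∈ R, ∀ r : ℝ, 0 ≤ r → r ≤ 1 → r • x + (1 - r) • y ∈ closure R) :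
    Convex ℝ (closure R) := by
  intro x hx y hy a b ha hb hab
  obtain rfl : b = 1 - a := by linarith
  have := map_mem_closure₂ (f := fun x y : E => a • x + (1 - a) • y) (u := closure R)
    (by fun_prop) hx hy (fun x hx y hy => h x hx y hy a ha (by linarith))
  rwa [closure_closure] at this

/-- A concave function on a compact interval is bounded above. -/
lemma ConcaveOn.exists_forall_le_of_Icc {a b : ℝ} {f : ℝ → ℝ} (hf : ConcaveOn ℝ (Set.Icc a b) f) :
    ∃ M, ∀ x ∈ Set.Icc a b, f x ≤ M := by
  -- The midpoint is the mean of `x` and its reflection `a + b - x`, where `f` is at least the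
  -- smaller endpoint value.
  refine ⟨2 * f ((a + b) / 2) - min (f a) (f b), fun x hx => ?_⟩
  have hab : a ≤ b := hx.1.trans hx.2
  have hx' : a + b - x ∈ Set.Icc a b := ⟨by linarith [hx.2], by linarith [hx.1]⟩
  have h1 := hf.min_le_of_mem_Icc (Set.left_mem_Icc.2 hab) (Set.right_mem_Icc.2 hab) hx'
  have h2 := hf.2 hx hx' (show (0 : ℝ) ≤ 1 / 2 by norm_num) (show (0 : ℝ) ≤ 1 / 2 by norm_num)
    (by norm_num)
  have h3 : (1 / 2 : ℝ) • x + (1 / 2 : ℝ) • (a + b - x) = (a + b) / 2 := by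
    simp only [smul_eq_mul]; ring
  rw [h3] at h2
  simp only [smul_eq_mul] at h2
  linarith

/-! ### The projected multiplier recursion -/

section ProjectedAscent

variable {K : Type*} {ε : ℝ} {ζ g : ℕ → K → ℝ}

lemma multiplier_nonneg (h1 : ∀ k, 0 ≤ ζ 1 k)
    (hstep : ∀ ℓ ≥ 1, ∀ k, ζ (ℓ + 1) k = max (ζ ℓ k + ε * g ℓ k) 0) {ℓ : ℕ} (hℓ : 1 ≤ ℓ) (k : K) :
    0 ≤ ζ ℓ k := by
  obtain _ | _ | n := ℓ
  · omega
  · exact h1 k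
  · rw [hstep (n + 1) (by omega)]
    exact le_max_right _ _

/-- The projection only increases each coordinate, so the multiplier dominates the unprojected sum.
-/
lemma sum_subgradient_le_multiplier (h1 : ∀ k, 0 ≤ ζ 1 k)
    (hstep : ∀ ℓ ≥ 1, ∀ k, ζ (ℓ + 1) k = max (ζ ℓ k + ε * g ℓ k) 0) (s : ℕ) (k : K) :
    ε * ∑ ℓ ∈ Finset.Icc 1 s, g ℓ k ≤ ζ (s + 1) k := by
  induction s with
  | zero => simpa using h1 k
  | succ s ih =>
    rw [Finset.sum_Icc_succ_top (by omega), mul_add, hstep (s + 1) (by omega)]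
    exact le_max_of_le_left (by linarith)

variable [Fintype K]

/-- Clipping at zero does not increase a square, so each step costs at most the expansion of the
unprojected square. -/
lemma sum_sq_multiplier_le {G : ℝ}
    (hstep : ∀ ℓ ≥ 1, ∀ k, ζ (ℓ + 1) k = max (ζ ℓ k + ε * g ℓ k) 0)
    (hG : ∀ ℓ ≥ 1, ∑ k, g ℓ k ^ 2 ≤ G ^ 2) (s : ℕ) :
    ∑ k, ζ (s + 1) k ^ 2 ≤
      ∑ k, ζ 1 k ^ 2 + 2 * ε * ∑ ℓ ∈ Finset.Icc 1 s, ∑ k, ζ ℓ k * g ℓ k + s * (ε ^ 2 * G ^ 2) := by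
  induction s with
  | zero => simp
  | succ s ih =>
    have hle : ∑ k, ζ (s + 1 + 1) k ^ 2 ≤ ∑ k, ζ (s + 1) k ^ 2 +
        2 * ε * ∑ k, ζ (s + 1) k * g (s + 1) k + ε ^ 2 * ∑ k, g (s + 1) k ^ 2 := by
      rw [Finset.mul_sum, Finset.mul_sum, ← Finset.sum_add_distrib, ← Finset.sum_add_distrib]
      refine Finset.sum_le_sum fun k _ => ?_
      rw [hstep (s + 1) (by omega)]
      rcases le_total (ζ (s + 1) k + ε * g (s + 1) k) 0 with h | h
      · rw [max_eq_right h]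
        nlinarith [sq_nonneg (ζ (s + 1) k + ε * g (s + 1) k)]
      · rw [max_eq_left h]
        exact le_of_eq (by ring)
    have h2 := mul_le_mul_of_nonneg_left (hG (s + 1) (by omega)) (sq_nonneg ε)
    rw [Finset.sum_Icc_succ_top (by omega), mul_add]
    push_cast
    linarith

/-- The multipliers grow sublinearly if their correlation with the subgradients is bounded above. -/
lemma tendsto_multiplier_div {G M : ℝ} (hε : 0 < ε)
    (hstep : ∀ ℓ ≥ 1, ∀ k, ζ (ℓ + 1) k = max (ζ ℓ k + ε * g ℓ k) 0)
    (hG : ∀ ℓ ≥ 1, ∑ k, g ℓ k ^ 2 ≤ G ^ 2) (hM : ∀ ℓ ≥ 1, ∑ k, ζ ℓ k * g ℓ k ≤ M) (k : K) :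
    Tendsto (fun s : ℕ => ζ (s + 1) k / s) atTop (𝓝 0) := by
  set c : ℝ := ∑ k, ζ 1 k ^ 2
  set d : ℝ := 2 * ε * M + ε ^ 2 * G ^ 2
  have hbound : ∀ s : ℕ, ζ (s + 1) k ^ 2 ≤ c + s * d := fun s => by
    have h1 : ζ (s + 1) k ^ 2 ≤ ∑ k, ζ (s + 1) k ^ 2 :=
      Finset.single_le_sum (f := fun k => ζ (s + 1) k ^ 2) (fun _ _ => sq_nonneg _)
        (Finset.mem_univ k)
    have h2 : ∑ ℓ ∈ Finset.Icc 1 s, ∑ k, ζ ℓ k * g ℓ k ≤ s * M := by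
      simpa using Finset.sum_le_card_nsmul (Finset.Icc 1 s) _ M
        fun ℓ hℓ => hM ℓ (Finset.mem_Icc.1 hℓ).1
    have h3 := mul_le_mul_of_nonneg_left h2 (by positivity : 0 ≤ 2 * ε)
    calc _ ≤ _ := h1
      _ ≤ _ := sum_sq_multiplier_le hstep hG s
      _ ≤ _ := by simp only [c, d]; linarith
  have hlim : Tendsto (fun s : ℕ => √(c * ((s : ℝ)⁻¹) ^ 2 + d * (s : ℝ)⁻¹)) atTop (𝓝 0) := by
    have h := tendsto_inv_atTop_nhds_zero_nat (𝕜 := ℝ)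
    have := (((h.pow 2).const_mul c).add (h.const_mul d)).sqrt
    simpa using this
  refine squeeze_zero_norm' ?_ hlim
  filter_upwards [eventually_ge_atTop 1] with s hs
  have hs' : (0 : ℝ) < s := by exact_mod_cast hs
  refine Real.le_sqrt_of_sq_le ?_
  rw [Real.norm_eq_abs, sq_abs, div_pow, div_le_iff₀ (by positivity)]
  calc _ ≤ _ := hbound s
    _ = _ := by field_simp

end ProjectedAscent

/-! ### Policies, box and objective -/

namespace Network

section Convexity

variable {Node Tone Session Gain : Type*} {net : Network Node Tone Session Gain}

/-- Any single channel gain can thus serve as the atomless variable used for splitting. -/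
lemma channel_hyperplane_eq_zero [Fintype Gain]
    (hcont : net.channel ≪ volume.restrict (Set.Ici (0 : Gain → ℝ))) (i : Gain) (t : ℝ) :
    net.channel ((fun h : Gain → ℝ => h i) ⁻¹' {t}) = 0 := by
  refine hcont (le_antisymm ((Measure.restrict_apply_le _ _).trans ?_) bot_le)
  exact (Measure.pi_hyperplane (fun _ : Gain => (volume : Measure ℝ)) i t).le

/-- Time sharing between two policies over the channel states. -/
lemma piecewise_mem_policies {π₁ π₂ : net.Policy} (h₁ : π₁ ∈ net.policies)
    (h₂ : π₂ ∈ net.policies) {A : Set (Gain → ℝ)} [DecidablePred (· ∈ A)] (hA : MeasurableSet A) :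
    A.piecewise π₁ π₂ ∈ net.policies := by
  refine ⟨h₁.1.piecewise hA h₂.1, ?_⟩
  filter_upwards [h₁.2, h₂.2] with h hh₁ hh₂
  by_cases hh : h ∈ A <;> simp [hh, hh₁, hh₂]

lemma convex_box : Convex ℝ net.box := by
  intro y hy y' hy' a b ha hb hab
  exact ⟨fun m => convex_Icc _ _ (hy.1 m) (hy'.1 m) ha hb hab,
    fun e m => convex_Icc _ _ (hy.2.1 e m) (hy'.2.1 e m) ha hb hab,
    fun l k => convex_Icc _ _ (hy.2.2.1 l k) (hy'.2.2.1 l k) ha hb hab,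
    fun e => convex_Icc _ _ (hy.2.2.2.1 e) (hy'.2.2.2.1 e) ha hb hab,
    fun i => convex_Icc _ _ (hy.2.2.2.2 i) (hy'.2.2.2.2 i) ha hb hab⟩

variable [Fintype Node] [Fintype Session]

lemma concaveOn_objective
    (hU : ∀ m, ConcaveOn ℝ (Set.Icc (net.aMin m) (net.aMax m)) (net.U m))
    (hV : ∀ i, ConvexOn ℝ (Set.Icc 0 (net.pMax i)) (net.V i)) :
    ConcaveOn ℝ net.box net.objective := by
  refine ⟨convex_box, fun y hy y' hy' a b ha hb hab => ?_⟩
  have h1 := Finset.sum_le_sum fun m (_ : m ∈ Finset.univ) =>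
    (hU m).2 (hy.1 m) (hy'.1 m) ha hb hab
  have h2 := Finset.sum_le_sum fun i (_ : i ∈ Finset.univ) =>
    (hV i).2 (hy.2.2.2.2 i) (hy'.2.2.2.2 i) ha hb hab
  simp only [smul_eq_mul, Finset.sum_add_distrib, ← Finset.mul_sum] at h1 h2
  simp only [objective, Pi.add_apply, Pi.smul_apply, smul_eq_mul]
  linarith

/-- Utilities and costs may jump at the endpoints of their intervals, so the bound comes from
concavity rather than from compactness. -/
lemma exists_objective_le
    (hU : ∀ m, ConcaveOn ℝ (Set.Icc (net.aMin m) (net.aMax m)) (net.U m))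
    (hV : ∀ i, ConvexOn ℝ (Set.Icc 0 (net.pMax i)) (net.V i)) :
    ∃ M, ∀ y ∈ net.box, net.objective y ≤ M := by
  choose A hA using fun m => (hU m).exists_forall_le_of_Icc
  choose B hB using fun i => (hV i).neg.exists_forall_le_of_Icc
  refine ⟨∑ m, A m + ∑ i, B i, fun y hy => ?_⟩
  rw [objective, sub_eq_add_neg, ← Finset.sum_neg_distrib]
  exact add_le_add (Finset.sum_le_sum fun m _ => hA m _ (hy.1 m))
    (Finset.sum_le_sum fun i _ => hB i _ (hy.2.2.2.2 i))

end Convexity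

/-! ### The constraint vector and its approximate convexity -/

variable {Node Tone Session Gain : Type*} [Fintype Node] [Fintype Tone] [Fintype Session]
  (net : Network Node Tone Session Gain)

open Classical in
/-- The part of the constraint vector that is linear in `y`. -/
noncomputable def linearPart : (net.Var → ℝ) →ₗ[ℝ] (net.Con → ℝ) :=
  { toFun := fun y k => match k with
      | .flow k i =>
          net.inflow y k i
            - ((∑ l : net.Link with l.1.1 = i.1, y (.x l k))
              - ∑ l : net.Link with l.1.2 = i.1, y (.x l k))
      | .union i K k =>
          (∑ l : net.Link with l.1.1 = i ∧ l.1.2 ∈ K.1, y (.x l k))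
            - ∑ e : net.Arc with e.1.1 = i ∧ ∃ j ∈ e.1.2, j ∈ K.1, y (.z e k.1)
      | .rate e => (∑ m, y (.z e m)) - y (.c e)
      | .capacity e => y (.c e)
      | .power i => - y (.p i)
    map_add' := fun y y' => by
      ext k
      rcases k with ⟨k, i⟩ | ⟨i, K, k⟩ | e | e | i
      · simp only [inflow, Pi.add_apply, Finset.sum_add_distrib]
        split_ifs <;> ring
      · simp only [Pi.add_apply, Finset.sum_add_distrib]
        ring
      · simp only [Pi.add_apply, Finset.sum_add_distrib]
        ring
      · simp
      · simp only [Pi.add_apply]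
        ring
    map_smul' := fun c y => by
      ext k
      rcases k with ⟨k, i⟩ | ⟨i, K, k⟩ | e | e | i
      · simp only [inflow, Pi.smul_apply, smul_eq_mul, RingHom.id_apply, ← Finset.mul_sum]
        split_ifs <;> ring
      · simp only [Pi.smul_apply, smul_eq_mul, RingHom.id_apply, ← Finset.mul_sum]
        ring
      · simp only [Pi.smul_apply, smul_eq_mul, RingHom.id_apply, ← Finset.mul_sum]
        ring
      · simp
      · simp }

open Classical in
/-- The integrand of the part of the constraint vector that depends on the policy. -/
noncomputable def policyIntegrand (π : net.Policy) (h : Gain → ℝ) : net.Con → ℝ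
  | .capacity e => - ∑ f, net.cap e f (π h) h
  | .power i => ∑ f, ∑ e : net.Arc with e.1.1 = i, π h e f
  | _ => 0

variable {net}

lemma integrable_policyIntegrand [IsProbabilityMeasure net.channel]
    (hbdd : Bornology.IsBounded net.powerSet)
    (hcap : ∀ π ∈ net.policies, ∀ e,
      Integrable (fun h => ∑ f, net.cap e f (π h) h) net.channel)
    {π : net.Policy} (hπ : π ∈ net.policies) :
    Integrable (net.policyIntegrand π) net.channel := by
  refine Integrable.of_eval fun k => ?_
  rcases k with ⟨k, i⟩ | ⟨i, K, k⟩ | e | e | i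
  · exact integrable_zero _ _ _
  · exact integrable_zero _ _ _
  · exact integrable_zero _ _ _
  · exact (hcap π hπ e).neg
  · refine integrable_finsetSum _ fun f _ => integrable_finsetSum _ fun e _ => ?_
    obtain ⟨C, hC⟩ := hbdd.exists_norm_le
    refine Integrable.of_bound (C := C) ?_ ?_
    · exact ((measurable_pi_apply f).comp
        ((measurable_pi_apply e).comp hπ.1)).aestronglyMeasurable
    · filter_upwards [hπ.2] with h hh
      exact (norm_le_pi_norm _ f).trans ((norm_le_pi_norm (π h) e).trans (hC _ hh))

/-- Convex combinations pass exactly through the part in `y`, so only the policy integral has to be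
approximated. -/
lemma constraint_eq_linearPart_add [IsProbabilityMeasure net.channel]
    (hbdd : Bornology.IsBounded net.powerSet)
    (hcap : ∀ π ∈ net.policies, ∀ e,
      Integrable (fun h => ∑ f, net.cap e f (π h) h) net.channel)
    (y : net.Var → ℝ) {π : net.Policy} (hπ : π ∈ net.policies) :
    net.constraint y π = net.linearPart y + ∫ h, net.policyIntegrand π h ∂net.channel := by
  ext k
  rw [Pi.add_apply, eval_integral
    (fun k => (integrable_policyIntegrand hbdd hcap hπ).eval k)]
  rcases k with ⟨k, i⟩ | ⟨i, K, k⟩ | e | e | i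
  · simp [constraint, linearPart, policyIntegrand]
  · simp [constraint, linearPart, policyIntegrand]
  · simp [constraint, linearPart, policyIntegrand]
  · simp [constraint, linearPart, policyIntegrand, integral_neg, sub_eq_add_neg]
  · simp [constraint, linearPart, policyIntegrand, sub_eq_neg_add]

lemma convex_closure_policyIntegrals [Fintype Gain] [Nonempty Gain]
    [IsProbabilityMeasure net.channel]
    (hcont : net.channel ≪ volume.restrict (Set.Ici (0 : Gain → ℝ)))
    (hbdd : Bornology.IsBounded net.powerSet)
    (hcap : ∀ π ∈ net.policies, ∀ e,
      Integrable (fun h => ∑ f, net.cap e f (π h) h) net.channel) :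
    Convex ℝ (closure ((fun π => ∫ h, net.policyIntegrand π h ∂net.channel) '' net.policies)) := by
  classical
  refine convex_closure_of_segment_mem_closure ?_
  rintro _ ⟨π₁, h₁, rfl⟩ _ ⟨π₂, h₂, rfl⟩ r hr0 hr1
  have i₁ := integrable_policyIntegrand hbdd hcap h₁
  have i₂ := integrable_policyIntegrand hbdd hcap h₂
  refine Metric.mem_closure_iff.2 fun δ hδ => ?_
  obtain ⟨i⟩ := ‹Nonempty Gain›
  -- The integrand depends on the policy pointwise in `h`, so switching on `A` yields `∫ u₂ + ∫_A
  -- (u₁ - u₂)`; hence the difference is what must be split.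
  obtain ⟨A, hA, hAδ⟩ := exists_setIntegral_near_smul (measurable_pi_apply i)
    (channel_hyperplane_eq_zero hcont i) (i₁.sub i₂) hr0 hr1 hδ
  refine ⟨_, ⟨A.piecewise π₁ π₂, piecewise_mem_policies h₁ h₂ hA, rfl⟩, ?_⟩
  have hpw : net.policyIntegrand (A.piecewise π₁ π₂) =
      A.piecewise (net.policyIntegrand π₁) (net.policyIntegrand π₂) := by
    funext h
    by_cases hh : h ∈ A
    · rw [Set.piecewise_eq_of_mem _ _ _ hh]
      funext k
      cases k <;> simp [policyIntegrand, hh]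
    · rw [Set.piecewise_eq_of_notMem _ _ _ hh]
      funext k
      cases k <;> simp [policyIntegrand, hh]
  simp only [Pi.sub_apply] at hAδ
  rw [integral_sub i₁ i₂, integral_sub i₁.restrict i₂.restrict] at hAδ
  rw [dist_comm, dist_eq_norm]
  simp only [hpw]
  rw [integral_piecewise hA i₁.integrableOn i₂.integrableOn, setIntegral_compl hA i₂]
  refine lt_of_eq_of_lt (congrArg (‖·‖) ?_) hAδ
  module

/-- The constraint vector is approximately convex in the pair `(y, p(·))`. -/
lemma exists_policy_constraint_sum_le [Fintype Gain] [Nonempty Gain]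
    [IsProbabilityMeasure net.channel]
    (hcont : net.channel ≪ volume.restrict (Set.Ici (0 : Gain → ℝ)))
    (hbdd : Bornology.IsBounded net.powerSet)
    (hcap : ∀ π ∈ net.policies, ∀ e,
      Integrable (fun h => ∑ f, net.cap e f (π h) h) net.channel)
    {ι : Type*} (s : Finset ι) (w : ι → ℝ) (hw0 : ∀ i ∈ s, 0 ≤ w i) (hw1 : ∑ i ∈ s, w i = 1)
    (y : ι → net.Var → ℝ) (π : ι → net.Policy) (hπ : ∀ i ∈ s, π i ∈ net.policies)
    {δ : ℝ} (hδ : 0 < δ) :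
    ∃ π' ∈ net.policies, ∀ k, net.constraint (∑ i ∈ s, w i • y i) π' k ≤
      ∑ i ∈ s, w i * net.constraint (y i) (π i) k + δ := by
  have hmem := (convex_closure_policyIntegrals hcont hbdd hcap).sum_mem hw0 hw1
    (fun i hi => subset_closure (Set.mem_image_of_mem _ (hπ i hi)))
  obtain ⟨_, ⟨π', hπ', rfl⟩, hdist⟩ := Metric.mem_closure_iff.1 hmem δ hδ
  refine ⟨π', hπ', fun k => ?_⟩
  have hk := (abs_lt.1 ((Real.dist_eq _ _) ▸ (dist_le_pi_dist _ _ k).trans_lt hdist)).1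
  have hsum : ∑ i ∈ s, w i * net.constraint (y i) (π i) k =
      net.linearPart (∑ i ∈ s, w i • y i) k +
        (∑ i ∈ s, w i • ∫ h, net.policyIntegrand (π i) h ∂net.channel) k := by
    simp only [map_sum, map_smul, Finset.sum_apply, Pi.smul_apply, smul_eq_mul]
    rw [← Finset.sum_add_distrib]
    refine Finset.sum_congr rfl fun i hi => ?_
    rw [constraint_eq_linearPart_add hbdd hcap _ (hπ i hi), Pi.add_apply, mul_add]
  rw [hsum, constraint_eq_linearPart_add hbdd hcap _ hπ', Pi.add_apply]
  linarith

end Network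

/-! ### Running averages and weak duality -/

namespace Network

variable {Node Tone Session Gain : Type*} {net : Network Node Tone Session Gain}

lemma runningAverage_eq_sum (y : ℕ → net.Var → ℝ) (s : ℕ) :
    net.runningAverage y s = ∑ ℓ ∈ Finset.Icc 1 s, (s : ℝ)⁻¹ • y ℓ := by
  rw [runningAverage, Finset.smul_sum]

lemma sum_Icc_inv_eq_one {s : ℕ} (hs : 1 ≤ s) : ∑ _ℓ ∈ Finset.Icc 1 s, (s : ℝ)⁻¹ = 1 := by
  have : (s : ℝ) ≠ 0 := by positivity
  simp [this]

lemma runningAverage_mem_box {y : ℕ → net.Var → ℝ} (hy : ∀ ℓ ≥ 1, y ℓ ∈ net.box) {s : ℕ}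
    (hs : 1 ≤ s) : net.runningAverage y s ∈ net.box := by
  rw [runningAverage_eq_sum]
  exact convex_box.sum_mem (fun _ _ => by positivity) (sum_Icc_inv_eq_one hs)
    fun ℓ hℓ => hy ℓ (Finset.mem_Icc.1 hℓ).1

variable [Fintype Node] [Fintype Session]

lemma sum_sq_le_of_norm_le {v : net.Con → ℝ} {G : ℝ} (h : net.norm v ≤ G) :
    ∑ k, v k ^ 2 ≤ G ^ 2 :=
  (Real.sqrt_le_iff.1 h).2

lemma tendsto_norm_proj {v : ℕ → net.Con → ℝ}
    (h : ∀ k, Tendsto (fun s => max (v s k) 0) atTop (𝓝 0)) :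
    Tendsto (fun s => net.norm (net.proj (v s))) atTop (𝓝 0) := by
  have := (tendsto_finsetSum Finset.univ fun k _ => (h k).pow 2).sqrt
  simpa [norm, proj] using this

variable [Fintype Tone]

lemma objective_le_optimalValue {M : ℝ} (hM : ∀ y ∈ net.box, net.objective y ≤ M)
    {y : net.Var → ℝ} {π : net.Policy} (h : (y, π) ∈ net.admissible)
    (hq : ∀ k, net.constraint y π k ≤ 0) : net.objective y ≤ net.optimalValue := by
  -- Boundedness is essential: the real `sSup` of an unbounded set is the default value `0`.
  refine le_csSup ⟨M, ?_⟩ ⟨y, π, h, hq, rfl⟩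
  rintro _ ⟨y, π, h, -, rfl⟩
  exact hM y h.1

/-- Weak duality. -/
lemma optimalValue_le_lagrangian {ζ : net.Con → ℝ} (hζ : ∀ k, 0 ≤ ζ k)
    (hfeas : ∃ y π, (y, π) ∈ net.admissible ∧ ∀ k, net.constraint y π k ≤ 0)
    {w : (net.Var → ℝ) × net.Policy} (hw : IsMaxOn (net.lagrangian ζ) net.admissible w) :
    net.optimalValue ≤ net.lagrangian ζ w := by
  obtain ⟨y₀, π₀, h₀, hq₀⟩ := hfeas
  refine csSup_le ⟨_, y₀, π₀, h₀, hq₀, rfl⟩ ?_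
  rintro _ ⟨y, π, h, hq, rfl⟩
  refine le_trans ?_ (hw h)
  have : ∑ k, ζ k * net.constraint y π k ≤ 0 :=
    Finset.sum_nonpos fun k _ => mul_nonpos_of_nonneg_of_nonpos (hζ k) (hq k)
  simp only [lagrangian]
  linarith

lemma IsSubgradientRun.step {ε : ℝ} {ζ : ℕ → net.Con → ℝ} {y : ℕ → net.Var → ℝ}
    {π : ℕ → net.Policy} (hrun : net.IsSubgradientRun ε ζ y π) :
    ∀ ℓ ≥ 1, ∀ k, ζ (ℓ + 1) k = max (ζ ℓ k + ε * net.constraint (y ℓ) (π ℓ) k) 0 := by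
  intro ℓ hℓ k
  rw [hrun.update ℓ hℓ]
  rfl

end Network

open Network

/-! ### The main theorem -/

open MeasureTheory Filter Topology in
theorem proposition3 {Node Tone Session Gain : Type*}
    [Fintype Node] [Fintype Tone] [Fintype Session] [Fintype Gain] [Nonempty Gain]
    (net : Network Node Tone Session Gain)
    -- the channel vector is a continuous random vector with nonnegative entries
    [IsProbabilityMeasure net.channel]
    (hcont : net.channel ≪ volume.restrict (Set.Ici (0 : Gain → ℝ)))
    -- bounded power constraint set, integrable capacities
    (hbdd : Bornology.IsBounded net.powerSet)
    (hcap : ∀ π ∈ net.policies, ∀ e,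
      Integrable (fun h => ∑ f, net.cap e f (π h) h) net.channel)
    -- concave utilities and convex costs
    (hU : ∀ m, ConcaveOn ℝ (Set.Icc (net.aMin m) (net.aMax m)) (net.U m))
    (hV : ∀ i, ConvexOn ℝ (Set.Icc 0 (net.pMax i)) (net.V i))
    -- Slater's condition
    (hslater : ∃ y π, (y, π) ∈ net.admissible ∧ ∀ k, net.constraint y π k < 0)
    -- the iterates and the bound on the subgradients
    (ε : ℝ) (hε : 0 < ε)
    (ζ : ℕ → net.Con → ℝ) (y : ℕ → net.Var → ℝ) (π : ℕ → net.Policy)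
    (hrun : net.IsSubgradientRun ε ζ y π)
    (G : ℝ) (hG : ∀ ℓ ≥ 1, net.norm (net.constraint (y ℓ) (π ℓ)) ≤ G) :
    (∃ π' : ℕ → net.Policy,
      (∀ s ≥ 1, (net.runningAverage y s, π' s) ∈ net.admissible) ∧
      Tendsto (fun s => net.norm (net.proj (net.constraint (net.runningAverage y s) (π' s))))
        atTop (𝓝 0)) ∧
    ((net.optimalValue - ε * G ^ 2 / 2 : ℝ) : EReal) ≤
      liminf (fun s => (net.objective (net.runningAverage y s) : EReal)) atTop ∧
    limsup (fun s => (net.objective (net.runningAverage y s) : EReal)) atTop ≤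
      (net.optimalValue : EReal) := by
  obtain ⟨y₀, π₀, h₀, hq₀⟩ := hslater
  obtain ⟨M, hM⟩ := exists_objective_le hU hV
  have hconc := concaveOn_objective hU hV
  have hstep := hrun.step
  have hζ : ∀ ℓ ≥ 1, ∀ k, 0 ≤ ζ ℓ k := fun ℓ hℓ k =>
    multiplier_nonneg (g := fun ℓ => net.constraint (y ℓ) (π ℓ)) hrun.init_nonneg hstep hℓ k
  have hG2 : ∀ ℓ ≥ 1, ∑ k, net.constraint (y ℓ) (π ℓ) k ^ 2 ≤ G ^ 2 :=
    fun ℓ hℓ => sum_sq_le_of_norm_le (hG ℓ hℓ)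
  have hbox : ∀ s : ℕ, 1 ≤ s → net.runningAverage y s ∈ net.box :=
    fun s hs => runningAverage_mem_box (fun ℓ hℓ => (hrun.mem ℓ hℓ).1) hs
  have hdual : ∀ ℓ ≥ 1, net.optimalValue ≤
      net.objective (y ℓ) - ∑ k, ζ ℓ k * net.constraint (y ℓ) (π ℓ) k := fun ℓ hℓ =>
    optimalValue_le_lagrangian (hζ ℓ hℓ) ⟨y₀, π₀, h₀, fun k => (hq₀ k).le⟩ (hrun.isMaxOn ℓ hℓ)
  have hgrowth : ∀ k, Tendsto (fun s : ℕ => ζ (s + 1) k / s) atTop (𝓝 0) :=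
    tendsto_multiplier_div (M := M - net.optimalValue) hε hstep hG2 fun ℓ hℓ => by
      linarith [hdual ℓ hℓ, hM _ (hrun.mem ℓ hℓ).1]
  -- The tolerance of the approximate time sharing; any positive null sequence would do.
  have hδ : ∀ s : ℕ, (0 : ℝ) < 1 / ((s : ℝ) + 1) := fun s => by positivity
  have hδ0 := tendsto_one_div_add_atTop_nhds_zero_nat (𝕜 := ℝ)
  -- policies that share the channel states among the first iterates
  have hshare : ∀ s : ℕ, ∃ π' : net.Policy, 1 ≤ s → π' ∈ net.policies ∧
      ∀ k, net.constraint (net.runningAverage y s) π' k ≤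
        ε⁻¹ * (ζ (s + 1) k / s) + 1 / ((s : ℝ) + 1) := by
    intro s
    by_cases hs : 1 ≤ s
    swap
    · exact ⟨π 1, fun h => absurd h hs⟩
    have hs' : (0 : ℝ) < s := by exact_mod_cast hs
    obtain ⟨π', hπ', hk⟩ := exists_policy_constraint_sum_le hcont hbdd hcap (Finset.Icc 1 s)
      (fun _ => (s : ℝ)⁻¹) (fun _ _ => by positivity) (sum_Icc_inv_eq_one hs) y π
      (fun ℓ hℓ => (hrun.mem ℓ (Finset.mem_Icc.1 hℓ).1).2) (hδ s)
    refine ⟨π', fun _ => ⟨hπ', fun k => ?_⟩⟩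
    have h := sum_subgradient_le_multiplier
      (g := fun ℓ => net.constraint (y ℓ) (π ℓ)) hrun.init_nonneg hstep s k
    rw [runningAverage_eq_sum]
    refine (hk k).trans ?_
    gcongr
    rw [← Finset.mul_sum, inv_mul_eq_div, inv_mul_eq_div, div_right_comm]
    gcongr
    rwa [le_div_iff₀' hε]
  choose π' hπ' using hshare
  have hviol : ∀ k, Tendsto
      (fun s => max (net.constraint (net.runningAverage y s) (π' s) k) 0) atTop (𝓝 0) := by
    intro k
    have hlim := ((hgrowth k).const_mul ε⁻¹).add hδ0
    rw [mul_zero, add_zero] at hlim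
    refine tendsto_of_tendsto_of_tendsto_of_le_of_le' tendsto_const_nhds hlim
      (Eventually.of_forall fun s => le_max_right _ _) ?_
    filter_upwards [eventually_ge_atTop 1] with s hs
    refine max_le ((hπ' s hs).2 k) ?_
    have := hζ (s + 1) (by omega) k
    positivity
  refine ⟨⟨π', fun s hs => ⟨hbox s hs, (hπ' s hs).1⟩, tendsto_norm_proj hviol⟩, ?_, ?_⟩
  · set Z : ℝ := ∑ k, ζ 1 k ^ 2 with hZ
    have hlim : Tendsto (fun s : ℕ => ((net.optimalValue - ε * G ^ 2 / 2 -
        Z / (2 * ε) * (s : ℝ)⁻¹ : ℝ) : EReal)) atTop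
        (𝓝 ((net.optimalValue - ε * G ^ 2 / 2 : ℝ) : EReal)) := by
      refine (continuous_coe_real_ereal.tendsto _).comp ?_
      simpa using (tendsto_const_nhds (x := net.optimalValue - ε * G ^ 2 / 2)).sub
        ((tendsto_inv_atTop_nhds_zero_nat (𝕜 := ℝ)).const_mul (Z / (2 * ε)))
    rw [← hlim.liminf_eq]
    refine liminf_le_liminf ?_
    filter_upwards [eventually_ge_atTop 1] with s hs
    have hs' : (0 : ℝ) < s := by exact_mod_cast hs
    rw [EReal.coe_le_coe_iff]
    have hjensen : ∑ ℓ ∈ Finset.Icc 1 s, (s : ℝ)⁻¹ * net.objective (y ℓ) ≤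
        net.objective (net.runningAverage y s) := by
      rw [runningAverage_eq_sum]
      exact hconc.le_map_sum (fun _ _ => by positivity) (sum_Icc_inv_eq_one hs)
        fun ℓ hℓ => (hrun.mem ℓ (Finset.mem_Icc.1 hℓ).1).1
    rw [← Finset.mul_sum] at hjensen
    have hsum : (s : ℝ) * net.optimalValue ≤ ∑ ℓ ∈ Finset.Icc 1 s, net.objective (y ℓ) -
        ∑ ℓ ∈ Finset.Icc 1 s, ∑ k, ζ ℓ k * net.constraint (y ℓ) (π ℓ) k := by
      rw [← Finset.sum_sub_distrib]
      simpa using Finset.card_nsmul_le_sum (Finset.Icc 1 s) _ net.optimalValue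
        fun ℓ hℓ => hdual ℓ (Finset.mem_Icc.1 hℓ).1
    have hsq := sum_sq_multiplier_le (g := fun ℓ => net.constraint (y ℓ) (π ℓ)) hstep hG2 s
    have hnn : 0 ≤ ∑ k, ζ (s + 1) k ^ 2 := Finset.sum_nonneg fun _ _ => sq_nonneg _
    refine le_trans ?_ hjensen
    rw [inv_mul_eq_div, le_div_iff₀ hs']
    set T := ∑ ℓ ∈ Finset.Icc 1 s, ∑ k, ζ ℓ k * net.constraint (y ℓ) (π ℓ) k
    -- This is `0 ≤ ‖ζ(s+1)‖²` inserted in `hsq`, divided by `2ε`; the term `ε G² / 2` of the bound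
    -- arises here.
    have hT : -(Z / (2 * ε)) - s * (ε * G ^ 2 / 2) ≤ T := by
      rw [← mul_le_mul_iff_right₀ (by positivity : 0 < 2 * ε)]
      have : 2 * ε * (-(Z / (2 * ε)) - s * (ε * G ^ 2 / 2)) = -Z - s * (ε ^ 2 * G ^ 2) := by
        field_simp
      linarith
    have : (net.optimalValue - ε * G ^ 2 / 2 - Z / (2 * ε) * (s : ℝ)⁻¹) * s =
        s * net.optimalValue - s * (ε * G ^ 2 / 2) - Z / (2 * ε) := by
      field_simp
    linarith
  · set D : ℝ := M - net.objective y₀ with hD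
    have hD0 : 0 ≤ D := sub_nonneg.2 (hM _ h₀.1)
    -- mixing in a small share of the Slater point restores feasibility
    have hmix : ∀ θ : ℝ, 0 < θ → θ < 1 → ∀ᶠ s in atTop,
        net.objective (net.runningAverage y s) ≤ net.optimalValue + θ * D := by
      intro θ hθ0 hθ1
      -- For each `k` the left side tends to `θ` times the Slater slack, which is negative; finitely
      -- many constraints make this simultaneous.
      have hneg : ∀ᶠ s : ℕ in atTop, ∀ k,
          (1 - θ) * max (net.constraint (net.runningAverage y s) (π' s) k) 0 +
            θ * net.constraint y₀ π₀ k + 1 / ((s : ℝ) + 1) < 0 := by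
        refine eventually_all.2 fun k => ?_
        have hlim := (((hviol k).const_mul (1 - θ)).add_const
          (θ * net.constraint y₀ π₀ k)).add hδ0
        refine hlim.eventually_lt_const ?_
        have := mul_neg_of_pos_of_neg hθ0 (hq₀ k)
        linarith
      filter_upwards [hneg, eventually_ge_atTop 1] with s hs hs1
      obtain ⟨π₁, hπ₁, hk⟩ := exists_policy_constraint_sum_le hcont hbdd hcap
        (Finset.univ : Finset Bool) (fun b => bif b then 1 - θ else θ)
        (fun b _ => by cases b <;> simp [hθ0.le, hθ1.le]) (by simp)
        (fun b => bif b then net.runningAverage y s else y₀)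
        (fun b => bif b then π' s else π₀)
        (fun b _ => by cases b <;> simp [h₀.2, (hπ' s hs1).1]) (hδ s)
      simp only [Fintype.sum_bool, cond_true, cond_false] at hk
      have hfeas := objective_le_optimalValue hM (π := π₁)
        (y := (1 - θ) • net.runningAverage y s + θ • y₀)
        ⟨convex_box (hbox s hs1) h₀.1 (by linarith) hθ0.le (by ring), hπ₁⟩ fun k => by
          have h1 := mul_le_mul_of_nonneg_left
            (le_max_left (net.constraint (net.runningAverage y s) (π' s) k) 0)
            (by linarith : 0 ≤ 1 - θ)
          linarith [hk k, hs k]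
      -- With feasibility of the mixture, concavity gives `f(ȳ) ≤ P + θ (f(ȳ) - f(y₀))`, and the
      -- bracket is at most `D`.
      have hval := hconc.2 (hbox s hs1) h₀.1 (by linarith : 0 ≤ 1 - θ) hθ0.le (by ring)
      simp only [smul_eq_mul] at hval
      have := mul_le_mul_of_nonneg_left (hM _ (hbox s hs1)) hθ0.le
      rw [hD, mul_sub]
      linarith
    refine EReal.le_of_forall_lt_iff_le.1 fun c hc => ?_
    rw [EReal.coe_lt_coe_iff] at hc
    -- Dividing by `D + 1` avoids a zero denominator, and `θ (D + 1) < c - P` still gives `P + θ D ≤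
    -- c`.
    obtain ⟨θ, hθ0, hθ⟩ : ∃ θ > 0, θ < min 1 ((c - net.optimalValue) / (D + 1)) :=
      exists_between (lt_min one_pos (div_pos (by linarith) (by linarith)))
    rw [lt_min_iff, lt_div_iff₀ (by linarith)] at hθ
    refine limsup_le_of_le (by isBoundedDefault) ?_
    filter_upwards [hmix θ hθ0 hθ.1] with s hs
    rw [EReal.coe_le_coe_iff]
    linarith [hθ.2]
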